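/- **Corollary 3.4 (greedy agents / greedy bandit algorithm).** *Model.* There are two arms with mean rewards $\mu_1,\mu_2\in[0,1]$; each time arm $a$ is sampled, a fresh independent Bernoulli reward of mean $\mu_a$ is drawn. Initially there are $N_0\ge 1$ samples of each arm. In each round $t=1,\dots,T$ a new agent observes the history (all initial samples and the arms and rewards of the previous agents), chooses an arm $a_t\in\{1,2\}$ with a largest index, ties being broken independently and uniformly at random, and receives a reward of that arm. The agents are *unbiased*: the index of each arm is the average reward of all samples of that arm in the history. The *$0$-sampling failure* is the event that all $T$ agents choose arm $2$, and $\mathrm{Regret}(T)=T\max(\mu_1,\mu_2)-\mathbb E\big[\sum_{t=1}^{T}\mu_{a_t}\big]$. *Statement.* Fix $c\in(0,1/2)$. 1. There are constants $C_1,C_2>0$ depending only on $c$ such that, for all $T$, all $N_0\ge 1/c$ and all $\mu_1,\mu_2$ with $c<\mu_2<\mu_1<1-c$, writing $\Delta=\mu_1-\mu_2$ and $p=C_1\,\Delta\, e^{-C_2N_0\Delta^2}$, the $0$-sampling failure has probability at least $p$, and $\mathrm{Regret}(T)\ge \Delta\cdot p\cdot T$. 2. For every $K>0$ there is a constant $C_3>0$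 depending only on $c$ and $K$ such that, under the same assumptions and if moreover $\Delta\le K/\sqrt{N_0}$, the $0$-sampling failure has probability at least $C_3\Delta$, and $\mathrm{Regret}(T)\ge \Delta\cdot C_3\Delta\cdot T$. -/

import Mathlib

/-! Bandit Social Learning with two arms. The elements `0` and `1` of `Fin 2` are the arms `1` and `2`
of the usual notation. A reward is a Boolean, `true` standing for reward `1` and `false` for `0`. -/

namespace BanditSocialLearning

/-- Histories after `t` agents: the `N₀` initial samples of each arm, together with the
arm-reward pairs `(a_s, r_s)` of the first `t` agents. This is what the next agent observes. -/
abbrev History (N₀ t : ℕ) : Type := (Fin 2 → Fin N₀ → Bool) × (Fin t → Fin 2 × Bool)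

/-- The numerical value of a reward. -/
def rewardValue (r : Bool) : ℝ := if r then 1 else 0

/-- The number of samples of arm `a` in a history, including the initial samples. -/
def numSamples {N₀ t : ℕ} (h : History N₀ t) (a : Fin 2) : ℕ :=
  N₀ + (Finset.univ.filter (fun s : Fin t => (h.2 s).1 = a)).card

/-- The average reward of the samples of arm `a` in a history, including the initial samples. -/
noncomputable def sampleAverage {N₀ t : ℕ} (h : History N₀ t) (a : Fin 2) : ℝ :=
  ((∑ i : Fin N₀, rewardValue (h.1 a i)) +
      ∑ s ∈ Finset.univ.filter (fun s : Fin t => (h.2 s).1 = a), rewardValue (h.2 s).2) /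
    (numSamples h a : ℝ)

/-- An index rule of the agent who arrives after `t` other agents: an index for each arm, as a
function of the observed history. -/
abbrev IndexRule (N₀ t : ℕ) : Type := History N₀ t → Fin 2 → ℝ

/-- An unbiased agent sets each index to the sample average of the arm. -/
def IsUnbiased {N₀ t : ℕ} (ind : IndexRule N₀ t) : Prop :=
  ∀ (h : History N₀ t) (a : Fin 2), ind h a = sampleAverage h a

open Classical in
/-- The arms with a largest index. -/
noncomputable def bestArms (x : Fin 2 → ℝ) : Finset (Fin 2) :=
  Finset.univ.filter (fun a => ∀ b, x b ≤ x a)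

theorem bestArms_nonempty (x : Fin 2 → ℝ) : (bestArms x).Nonempty := by
  obtain ⟨a, ha⟩ := Finite.exists_max x
  exact ⟨a, by simpa [bestArms] using ha⟩

/-- The choice of an arm with a largest index, ties being broken uniformly at random. -/
noncomputable def chooseArm (x : Fin 2 → ℝ) : PMF (Fin 2) :=
  PMF.uniformOfFinset (bestArms x) (bestArms_nonempty x)

theorem sum_bernoulli (p : unitInterval) :
    ∑ r : Bool, (if r then ENNReal.ofReal p else ENNReal.ofReal (1 - p)) = 1 := by
  have h0 : (0 : ℝ) ≤ p := p.2.1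
  have h1 : (0 : ℝ) ≤ 1 - p := sub_nonneg.mpr p.2.2
  simp [← ENNReal.ofReal_add h0 h1]

/-- The law of a Bernoulli reward of mean `p`. -/
noncomputable def rewardLaw (p : unitInterval) : PMF Bool :=
  PMF.ofFintype (fun r => if r then ENNReal.ofReal p else ENNReal.ofReal (1 - p))
    (sum_bernoulli p)

theorem sum_initial (μ : Fin 2 → unitInterval) (N₀ : ℕ) :
    ∑ x : Fin 2 → Fin N₀ → Bool, ∏ a, ∏ i, rewardLaw (μ a) (x a i) = 1 := by
  have h1 : ∀ a : Fin 2, ∑ y : Fin N₀ → Bool, ∏ i, rewardLaw (μ a) (y i) = 1 := by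
    intro a
    have h2 : ∑ r : Bool, rewardLaw (μ a) r = 1 := by
      simpa only [tsum_fintype] using (rewardLaw (μ a)).tsum_coe
    rw [← Fintype.prod_sum (fun (_ : Fin N₀) (r : Bool) => rewardLaw (μ a) r)]
    simp only [h2, Finset.prod_const_one]
  rw [← Fintype.prod_sum (fun (a : Fin 2) (y : Fin N₀ → Bool) => ∏ i, rewardLaw (μ a) (y i))]
  simp only [h1, Finset.prod_const_one]

/-- The law of the initial data: independent samples, those of arm `a` being Bernoulli of
mean `μ a`. -/
noncomputable def initialLaw (μ : Fin 2 → unitInterval) (N₀ : ℕ) :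
    PMF (Fin 2 → Fin N₀ → Bool) :=
  PMF.ofFintype (fun x => ∏ a, ∏ i, rewardLaw (μ a) (x a i)) (sum_initial μ N₀)

/-- The law of the history after `t` agents. In each round the arriving agent observes the history,
chooses an arm by means of its index rule, and a fresh Bernoulli reward of that arm is drawn;
the new arm-reward pair is appended to the history. -/
noncomputable def historyLaw (μ : Fin 2 → unitInterval) (N₀ : ℕ)
    (ind : (t : ℕ) → IndexRule N₀ t) : (t : ℕ) → PMF (History N₀ t)
  | 0 => (initialLaw μ N₀).map (fun x => (x, Fin.elim0))
  | t + 1 => (historyLaw μ N₀ ind t).bind fun h =>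
      (chooseArm (ind t h)).bind fun a =>
        (rewardLaw (μ a)).map fun r => (h.1, Fin.snoc h.2 (a, r))

/-- The `n`-sampling failure: all but at most `n` of the `T` agents choose the bad arm
(the second arm). -/
def samplingFailure (N₀ T n : ℕ) : Set (History N₀ T) :=
  {h | (Finset.univ.filter (fun t : Fin T => (h.2 t).1 ≠ 1)).card ≤ n}

/-- The probability of the `n`-sampling failure. -/
noncomputable def failureProb (μ : Fin 2 → unitInterval) (N₀ : ℕ)
    (ind : (t : ℕ) → IndexRule N₀ t) (T n : ℕ) : ℝ :=
  (historyLaw μ N₀ ind T).toMeasure.real (samplingFailure N₀ T n)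

/-- Regret: `max (μ₁, μ₂) * T` minus the expectation of the sum of `μ_{a_t}` over the agents. -/
noncomputable def regret (μ : Fin 2 → unitInterval) (N₀ : ℕ)
    (ind : (t : ℕ) → IndexRule N₀ t) (T : ℕ) : ℝ :=
  max (μ 0 : ℝ) (μ 1 : ℝ) * T -
    ∫ h, (∑ t : Fin T, (μ (h.2 t).1 : ℝ)) ∂(historyLaw μ N₀ ind T).toMeasure

end BanditSocialLearning

/-! Two independent events make every agent choose the bad arm. Put `Δ = μ 0 - μ 1` and let
`x = μ 1 - c Δ` be a threshold slightly below the mean of the bad arm.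

The first event is that the initial average of the good arm is at most `x`, about `Δ` below its
mean. Its probability is at least `const * exp (-O(N₀ Δ²))`
(`le_sum_sampleWeight_lower_tail`): by the Cauchy-Schwarz inequality one may pass to Bernoulli
variables of mean `x - 2 / √N₀`, the price being an exponential of the χ²-divergence, and under the
new mean the event has probability at least `1 / 2` by a Chernoff bound.

The second event is that all averages of the bad arm, from the initial samples on, exceed `x`. With
`W` the total reward of the bad arm minus `x` per sample, `W` has drift `c Δ`, and
`exp (-c Δ W)` is a supermartingale. Gambler's ruin then gives the event probability at
least a constant times `Δ`, as the first sample is a success with probability at least `c`. On both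
events the sample average of the bad arm is strictly larger at all times, so that the good arm is
never sampled again and ties never occur. In the formal argument the second event is replaced by
`potential`, a submartingale along the history (`potential_le_expect_step`) which is bounded above
by the indicator of failure.

The regret bound holds because each choice of the bad arm costs `Δ`, and the bound for
`Δ ≤ K / √N₀` because then `N₀ Δ² ≤ K²`. -/

namespace BanditSocialLearning

/-! ### Expectations over finite probability spaces -/

/-- The expectation of `g` under a probability mass function on a finite type. -/
noncomputable def expect {α : Type*} [Fintype α] (p : PMF α) (g : α → ℝ) : ℝ :=
  ∑ a, (p a).toReal * g a

theorem expect_mono {α : Type*} [Fintype α] (p : PMF α) {f g : α → ℝ} (h : ∀ a, f a ≤ g a) :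
    expect p f ≤ expect p g :=
  Finset.sum_le_sum fun a _ => mul_le_mul_of_nonneg_left (h a) ENNReal.toReal_nonneg

theorem expect_nonneg {α : Type*} [Fintype α] (p : PMF α) {g : α → ℝ} (h : ∀ a, 0 ≤ g a) :
    0 ≤ expect p g :=
  Finset.sum_nonneg fun a _ => mul_nonneg ENNReal.toReal_nonneg (h a)

theorem expect_const {α : Type*} [Fintype α] (p : PMF α) (k : ℝ) : expect p (fun _ => k) = k := by
  have h : ∑ a, (p a).toReal = 1 := by
    rw [← ENNReal.toReal_sum fun a _ => p.apply_ne_top a, ← tsum_fintype (L := .unconditional α), p.tsum_coe]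
    rfl
  rw [expect, ← Finset.sum_mul, h, one_mul]

theorem expect_pure {α : Type*} [Fintype α] (a : α) (g : α → ℝ) : expect (PMF.pure a) g = g a := by
  classical
  rw [expect, Finset.sum_eq_single a] <;> simp +contextual [PMF.pure_apply]

theorem expect_bind {α β : Type*} [Fintype α] [Fintype β] (p : PMF α) (f : α → PMF β)
    (g : β → ℝ) : expect (p.bind f) g = expect p fun a => expect (f a) g := by
  have h : ∀ b, ((p.bind f) b).toReal = ∑ a, (p a).toReal * (f a b).toReal := by
    intro b
    rw [PMF.bind_apply, tsum_fintype, ENNReal.toReal_sum]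
    · simp only [ENNReal.toReal_mul]
    · exact fun a _ => ENNReal.mul_ne_top (p.apply_ne_top a) ((f a).apply_ne_top b)
  simp only [expect, h, Finset.sum_mul, Finset.mul_sum, mul_assoc]
  exact Finset.sum_comm

theorem expect_map {α β : Type*} [Fintype α] [Fintype β] (p : PMF α) (f : α → β)
    (g : β → ℝ) : expect (p.map f) g = expect p fun a => g (f a) := by
  rw [← PMF.bind_pure_comp, expect_bind]
  simp only [Function.comp, expect_pure]

theorem integral_eq_expect {α : Type*} [Fintype α] [MeasurableSpace α]
    [MeasurableSingletonClass α] (p : PMF α) (g : α → ℝ) :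
    ∫ a, g a ∂p.toMeasure = expect p g := by
  simp [PMF.integral_eq_sum, expect]

open Classical in
theorem measureReal_eq_expect {α : Type*} [Fintype α] [MeasurableSpace α]
    [MeasurableSingletonClass α] (p : PMF α) (s : Set α) :
    p.toMeasure.real s = expect p fun a => if a ∈ s then 1 else 0 := by
  rw [← integral_eq_expect, ← MeasureTheory.integral_indicator_one s.toFinite.measurableSet]
  simp only [Set.indicator_apply, Pi.one_apply]

/-! ### Products of Bernoulli laws -/

/-- The Bernoulli weight of mean `p` (a probability when `0 ≤ p ≤ 1`). -/
def bernoulliWeight (p : ℝ) (r : Bool) : ℝ := if r then p else 1 - p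

/-- The weight of the sample `y` under `n` independent Bernoulli draws of mean `p`. -/
def sampleWeight {n : ℕ} (p : ℝ) (y : Fin n → Bool) : ℝ := ∏ i, bernoulliWeight p (y i)

/-- The sum of the rewards of a sample. -/
def sampleSum {n : ℕ} (y : Fin n → Bool) : ℝ := ∑ i, rewardValue (y i)

theorem rewardLaw_toReal (p : unitInterval) (r : Bool) :
    (rewardLaw p r).toReal = bernoulliWeight p r := by
  have h0 : (0 : ℝ) ≤ p := p.2.1
  have h1 : (0 : ℝ) ≤ 1 - p := sub_nonneg.mpr p.2.2
  cases r <;> simp [rewardLaw, bernoulliWeight, ENNReal.toReal_ofReal, h0, h1]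

theorem bernoulliWeight_nonneg {p : ℝ} (h0 : 0 ≤ p) (h1 : p ≤ 1) (r : Bool) :
    0 ≤ bernoulliWeight p r := by
  cases r <;> simp [bernoulliWeight, h0, h1]

theorem sampleWeight_nonneg {n : ℕ} {p : ℝ} (h0 : 0 ≤ p) (h1 : p ≤ 1) (y : Fin n → Bool) :
    0 ≤ sampleWeight p y :=
  Finset.prod_nonneg fun _ _ => bernoulliWeight_nonneg h0 h1 _

theorem sum_sampleWeight_mul_prod {n : ℕ} (p : ℝ) (f : Fin n → Bool → ℝ) :
    ∑ y : Fin n → Bool, sampleWeight p y * ∏ i, f i (y i) =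
      ∏ i, (p * f i true + (1 - p) * f i false) := by
  simp only [sampleWeight, ← Finset.prod_mul_distrib]
  rw [← Fintype.prod_sum fun i r => bernoulliWeight p r * f i r]
  simp [bernoulliWeight]

theorem sum_sampleWeight {n : ℕ} (p : ℝ) : ∑ y : Fin n → Bool, sampleWeight p y = 1 := by
  simpa using sum_sampleWeight_mul_prod (n := n) p fun _ _ => 1

theorem exp_mul_sampleSum_sub {n : ℕ} (l x : ℝ) (y : Fin n → Bool) :
    Real.exp (l * (sampleSum y - x * n)) = ∏ i, Real.exp (l * (rewardValue (y i) - x)) := by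
  rw [← Real.exp_sum, ← Finset.mul_sum, Finset.sum_sub_distrib]
  simp [sampleSum, mul_comm]

/-- A quadratic bound on the moment generating function of a Bernoulli variable centred at `x`. -/
theorem bernoulli_mgf_le {p x l : ℝ} (hp0 : 0 ≤ p) (hp1 : p ≤ 1) (hx0 : 0 ≤ x) (hx1 : x ≤ 1)
    (hl : |l| ≤ 1) :
    p * Real.exp (l * (1 - x)) + (1 - p) * Real.exp (l * (0 - x)) ≤ 1 + l * (p - x) + l ^ 2 := by
  have key : ∀ z : ℝ, |z| ≤ 1 → Real.exp (l * z) ≤ 1 + l * z + l ^ 2 := by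
    intro z hz
    have hlz : |l * z| ≤ 1 := by
      rw [abs_mul]
      exact mul_le_one₀ hl (abs_nonneg z) hz
    have h1 := (abs_le.mp (Real.abs_exp_sub_one_sub_id_le hlz)).2
    have h2 : z ^ 2 ≤ 1 := (sq_le_one_iff_abs_le_one z).mpr hz
    nlinarith [sq_nonneg l]
  have h1 := mul_le_mul_of_nonneg_left (key (1 - x) (abs_le.mpr ⟨by linarith, by linarith⟩)) hp0
  have h2 := mul_le_mul_of_nonneg_left (key (0 - x) (abs_le.mpr ⟨by linarith, by linarith⟩))
    (sub_nonneg.mpr hp1)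
  linarith

/-! ### A lower bound on the lower tail of a binomial law -/

/-- Change of measure: by the Cauchy-Schwarz inequality, an event that is likely under mean `q` is
not much less likely under mean `p`; the loss is the `n`-th power of `∑ r, q(r)² / p(r)`. -/
theorem sq_sum_sampleWeight_le {n : ℕ} {p : ℝ} (q : ℝ) (hp0 : 0 < p) (hp1 : p < 1)
    (A : Finset (Fin n → Bool)) :
    (∑ y ∈ A, sampleWeight q y) ^ 2 ≤
      (∑ y ∈ A, sampleWeight p y) * Real.exp (n * ((p - q) ^ 2 / (p * (1 - p)))) := by
  have hp1' : 0 < 1 - p := sub_pos.mpr hp1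
  have hpos : ∀ r, 0 < bernoulliWeight p r := by
    intro r
    cases r <;> simp [bernoulliWeight, hp0, hp1]
  set g : (Fin n → Bool) → ℝ :=
    fun y => ∏ i, (bernoulliWeight q (y i) ^ 2 / bernoulliWeight p (y i)) with hg
  have hg0 : ∀ y, 0 ≤ g y := fun y =>
    Finset.prod_nonneg fun i _ => div_nonneg (sq_nonneg _) (hpos _).le
  have hCS : (∑ y ∈ A, sampleWeight q y) ^ 2 ≤ (∑ y ∈ A, sampleWeight p y) * ∑ y ∈ A, g y := by
    refine Finset.sum_sq_le_sum_mul_sum_of_sq_le_mul A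
      (fun y _ => sampleWeight_nonneg hp0.le hp1.le y) (fun y _ => hg0 y) fun y _ => ?_
    rw [hg, sampleWeight, sampleWeight, ← Finset.prod_pow, ← Finset.prod_mul_distrib]
    exact (Finset.prod_congr rfl fun i _ => (mul_div_cancel₀ _ (hpos (y i)).ne').symm).le
  refine hCS.trans (mul_le_mul_of_nonneg_left ?_
    (Finset.sum_nonneg fun y _ => sampleWeight_nonneg hp0.le hp1.le y))
  calc ∑ y ∈ A, g y ≤ ∑ y, g y :=
        Finset.sum_le_sum_of_subset_of_nonneg (Finset.subset_univ A) fun y _ _ => hg0 y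
    _ = (1 + (p - q) ^ 2 / (p * (1 - p))) ^ n := by
        rw [hg, ← Fintype.prod_sum fun (_ : Fin n) r =>
          bernoulliWeight q r ^ 2 / bernoulliWeight p r]
        simp only [Finset.prod_const, Finset.card_univ, Fintype.card_fin]
        congr 1
        simp only [Fintype.sum_bool, bernoulliWeight]
        simp only [if_true, Bool.false_eq_true, if_false]
        field_simp
        ring
    _ ≤ Real.exp ((p - q) ^ 2 / (p * (1 - p))) ^ n := by
        refine pow_le_pow_left₀ (by positivity) ?_ n
        rw [add_comm]
        exact Real.add_one_le_exp _
    _ = Real.exp (n * ((p - q) ^ 2 / (p * (1 - p)))) := by rw [← Real.exp_nat_mul]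

/-- Chernoff bound: a sample sum exceeds its mean by `2 * √n` with probability at most `1 / 2`. -/
theorem half_le_sum_sampleWeight {n : ℕ} (hn : 1 ≤ n) {q : ℝ} (hq0 : 0 ≤ q) (hq1 : q ≤ 1) :
    1 / 2 ≤ ∑ y : Fin n → Bool with sampleSum y ≤ (q + 2 / √n) * n, sampleWeight q y := by
  have hn' : (1 : ℝ) ≤ n := by exact_mod_cast hn
  have hs : 1 ≤ √(n : ℝ) := Real.one_le_sqrt.mpr hn'
  have hs0 : 0 < √(n : ℝ) := by linarith
  have hss : √(n : ℝ) * √n = n := Real.mul_self_sqrt (by linarith)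
  set l : ℝ := 1 / √n with hl
  have hl0 : 0 < l := by positivity
  have hl1 : l ≤ 1 := by rw [hl, div_le_one hs0]; exact hs
  have hln : l ^ 2 * n = 1 := by
    rw [hl, div_pow, one_pow, Real.sq_sqrt (by linarith)]
    field_simp
  have hmgf : ∑ y : Fin n → Bool, sampleWeight q y * Real.exp (l * (sampleSum y - q * n)) ≤
      Real.exp 1 := by
    simp only [exp_mul_sampleSum_sub]
    rw [sum_sampleWeight_mul_prod q fun _ r => Real.exp (l * (rewardValue r - q))]
    simp only [Finset.prod_const, Finset.card_univ, Fintype.card_fin]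
    have h1 : q * Real.exp (l * (rewardValue true - q)) +
        (1 - q) * Real.exp (l * (rewardValue false - q)) ≤ Real.exp (l ^ 2) := by
      have := bernoulli_mgf_le hq0 hq1 hq0 hq1 (abs_le.mpr ⟨by linarith, hl1⟩ : |l| ≤ 1)
      have h2 := Real.add_one_le_exp (l ^ 2)
      simp only [rewardValue, if_true, Bool.false_eq_true, if_false]
      linarith
    calc _ ≤ Real.exp (l ^ 2) ^ n := by
          refine pow_le_pow_left₀ ?_ h1 n
          have : 0 ≤ 1 - q := by linarith
          positivity
      _ = Real.exp 1 := by rw [← Real.exp_nat_mul, mul_comm, hln]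
  have hbad : (∑ y : Fin n → Bool with ¬ sampleSum y ≤ (q + 2 / √n) * n, sampleWeight q y) *
      Real.exp 2 ≤ Real.exp 1 := by
    refine le_trans ?_ hmgf
    rw [Finset.sum_mul]
    refine (Finset.sum_le_sum fun y hy => ?_).trans
      (Finset.sum_le_sum_of_subset_of_nonneg (Finset.subset_univ _) fun y _ _ =>
        mul_nonneg (sampleWeight_nonneg hq0 hq1 y) (Real.exp_pos _).le)
    refine mul_le_mul_of_nonneg_left (Real.exp_le_exp.mpr ?_) (sampleWeight_nonneg hq0 hq1 y)
    have hy' := not_le.mp (Finset.mem_filter.mp hy).2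
    have h3 : (2 : ℝ) / √n * n = 2 * √n := by
      rw [div_mul_eq_mul_div, div_eq_iff hs0.ne', mul_assoc, hss]
    have h4 : 2 * √(n : ℝ) ≤ sampleSum y - q * n := by linarith
    have h5 := mul_le_mul_of_nonneg_left h4 hl0.le
    have h6 : l * (2 * √(n : ℝ)) = 2 := by rw [hl]; field_simp
    linarith
  have hsum := Finset.sum_filter_add_sum_filter_not Finset.univ
    (fun y : Fin n → Bool => sampleSum y ≤ (q + 2 / √n) * n) (sampleWeight q)
  rw [sum_sampleWeight] at hsum
  have he : Real.exp 2 = Real.exp 1 * Real.exp 1 := by rw [← Real.exp_add]; norm_num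
  have he1 : 2 ≤ Real.exp 1 := by linarith [Real.add_one_le_exp (1 : ℝ)]
  rw [he, ← mul_assoc] at hbad
  have hbad' : (∑ y : Fin n → Bool with ¬ sampleSum y ≤ (q + 2 / √n) * n, sampleWeight q y) *
      Real.exp 1 ≤ 1 := by
    refine le_of_mul_le_mul_right ?_ (Real.exp_pos 1)
    rwa [one_mul]
  have hnn : 0 ≤ ∑ y : Fin n → Bool with ¬ sampleSum y ≤ (q + 2 / √n) * n, sampleWeight q y :=
    Finset.sum_nonneg fun y _ => sampleWeight_nonneg hq0 hq1 y
  nlinarith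

/-- Reverse Chernoff bound: a sample average of mean `p` is below `x` with probability at least
`exp (-O(1 + n (p - x)²))`, the constant depending on `p (1 - p)`. -/
theorem le_sum_sampleWeight_lower_tail {n : ℕ} (hn : 1 ≤ n) {p x : ℝ} (hp0 : 0 < p) (hp1 : p < 1)
    (hx0 : 0 ≤ x) (hxp : x ≤ p) :
    1 / 4 * Real.exp (-((2 * (n * (p - x) ^ 2) + 8) / (p * (1 - p)))) ≤
      ∑ y : Fin n → Bool with sampleSum y ≤ x * n, sampleWeight p y := by
  have hn' : (1 : ℝ) ≤ n := by exact_mod_cast hn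
  have hs0 : 0 < √(n : ℝ) := Real.sqrt_pos.mpr (by linarith)
  have hv : 0 < p * (1 - p) := mul_pos hp0 (sub_pos.mpr hp1)
  have ht0 : 0 < 2 / √(n : ℝ) := by positivity
  -- The auxiliary mean is `2 / √n` below `x`, truncated at `0`, where all rewards vanish.
  obtain ⟨q, hqx, hpq, hhalf⟩ : ∃ q : ℝ, q ≤ p ∧ p - q ≤ (p - x) + 2 / √n ∧
      1 / 2 ≤ ∑ y : Fin n → Bool with sampleSum y ≤ x * n, sampleWeight q y := by
    rcases le_total (2 / √(n : ℝ)) x with h | h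
    · refine ⟨x - 2 / √n, by linarith, by linarith, ?_⟩
      simpa using half_le_sum_sampleWeight hn (q := x - 2 / √n) (by linarith) (by linarith)
    · refine ⟨0, hp0.le, by linarith, ?_⟩
      have hmem : (fun _ => false) ∈
          Finset.univ.filter fun y : Fin n → Bool => sampleSum y ≤ x * n := by
        refine Finset.mem_filter.mpr ⟨Finset.mem_univ _, ?_⟩
        have h0 : sampleSum (fun _ : Fin n => false) = 0 := by simp [sampleSum, rewardValue]
        rw [h0]
        positivity
      have := Finset.single_le_sum (f := sampleWeight (n := n) 0)
        (fun y _ => sampleWeight_nonneg le_rfl zero_le_one y) hmem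
      have h1 : sampleWeight 0 (fun _ : Fin n => false) = 1 := by
        simp [sampleWeight, bernoulliWeight]
      linarith
  set P := ∑ y : Fin n → Bool with sampleSum y ≤ x * n, sampleWeight p y
  have hP : 0 ≤ P := Finset.sum_nonneg fun y _ => sampleWeight_nonneg hp0.le hp1.le y
  have hCS := sq_sum_sampleWeight_le (n := n) q hp0 hp1
    (Finset.univ.filter fun y : Fin n → Bool => sampleSum y ≤ x * n)
  have hexp : n * ((p - q) ^ 2 / (p * (1 - p))) ≤
      (2 * (n * (p - x) ^ 2) + 8) / (p * (1 - p)) := by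
    rw [← mul_div_assoc]
    refine div_le_div_of_nonneg_right ?_ hv.le
    have h1 : (p - q) ^ 2 ≤ 2 * (p - x) ^ 2 + 2 * (2 / √(n : ℝ)) ^ 2 := by
      nlinarith [sq_nonneg ((p - x) - 2 / √(n : ℝ)), pow_le_pow_left₀ (sub_nonneg.mpr hqx) hpq 2]
    have h2 : (n : ℝ) * (2 / √(n : ℝ)) ^ 2 = 4 := by
      rw [div_pow, Real.sq_sqrt (by linarith)]
      field_simp
      norm_num
    have h3 := mul_le_mul_of_nonneg_left h1 (by linarith : (0 : ℝ) ≤ n)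
    linarith
  have h4 : 1 / 4 ≤ P * Real.exp ((2 * (n * (p - x) ^ 2) + 8) / (p * (1 - p))) := by
    have := mul_le_mul_of_nonneg_left (Real.exp_le_exp.mpr hexp) hP
    nlinarith
  rw [Real.exp_neg, ← div_eq_mul_inv, div_le_iff₀ (Real.exp_pos _)]
  exact h4

/-! ### Persistence of the good impression of the second arm -/

theorem expect_initialLaw_mul (μ : Fin 2 → unitInterval) (N₀ : ℕ)
    (F G : (Fin N₀ → Bool) → ℝ) :
    expect (initialLaw μ N₀) (fun x => F (x 0) * G (x 1)) =
      (∑ y, sampleWeight (μ 0) y * F y) * ∑ y, sampleWeight (μ 1) y * G y := by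
  have h : ∀ x, (initialLaw μ N₀ x).toReal = ∏ a, sampleWeight (μ a) (x a) := by
    intro x
    simp [initialLaw, sampleWeight, ENNReal.toReal_prod, rewardLaw_toReal]
  have h2 := Fintype.prod_sum fun (a : Fin 2) (y : Fin N₀ → Bool) =>
    sampleWeight (μ a) y * (![F, G] a) y
  simp only [Fin.prod_univ_two, Matrix.cons_val_zero, Matrix.cons_val_one] at h2
  rw [h2, expect]
  refine Finset.sum_congr rfl fun x _ => ?_
  rw [h, Fin.prod_univ_two]
  ring

theorem chooseArm_eq_pure {z : Fin 2 → ℝ} (h : z 0 < z 1) : chooseArm z = PMF.pure 1 := by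
  have hb : bestArms z = {1} := by
    ext a
    fin_cases a
    · simpa [bestArms] using h
    · simpa [bestArms] using h.le
  ext a
  simp [chooseArm, PMF.uniformOfFinset_apply, hb, PMF.pure_apply]

/-- The excess of the total reward of the second arm over `x` per sample, in a history in which
every agent has chosen that arm. -/
noncomputable def excess (x : ℝ) {N₀ t : ℕ} (h : History N₀ t) : ℝ :=
  sampleSum (h.1 1) + ∑ s, rewardValue (h.2 s).2 - x * (N₀ + t)

open Classical in
/-- A lower bound on the conditional probability, given the history, that all agents choose the
second arm. It vanishes unless all past agents chose that arm and the initial average of the first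
arm is at most `x`; otherwise it is the positive part of the gambler's-ruin bound
`1 - exp (-l * excess)` for the probability that the excess stays positive. -/
noncomputable def potential (x l : ℝ) {N₀ t : ℕ} (h : History N₀ t) : ℝ :=
  if (∀ s, (h.2 s).1 = 1) ∧ sampleSum (h.1 0) ≤ x * N₀ then
    max 0 (1 - Real.exp (-l * excess x h)) else 0

theorem potential_nonneg (x l : ℝ) {N₀ t : ℕ} (h : History N₀ t) : 0 ≤ potential x l h := by
  unfold potential
  split_ifs
  · exact le_max_left _ _
  · exact le_rfl

theorem excess_snoc (x : ℝ) {N₀ t : ℕ} (h : History N₀ t) (a : Fin 2) (r : Bool) :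
    excess x ((h.1, Fin.snoc h.2 (a, r)) : History N₀ (t + 1)) =
      excess x h + (rewardValue r - x) := by
  simp only [excess, Fin.sum_univ_castSucc, Fin.snoc_castSucc, Fin.snoc_last]
  push_cast
  ring

/-- When every agent has chosen the second arm, a positive excess means that the second arm has
the larger sample average. -/
theorem sampleAverage_lt_of_excess_pos {x : ℝ} {N₀ t : ℕ} (hN : 1 ≤ N₀) {h : History N₀ t}
    (hall : ∀ s, (h.2 s).1 = 1) (hlow : sampleSum (h.1 0) ≤ x * N₀) (hpos : 0 < excess x h) :
    sampleAverage h 0 < sampleAverage h 1 := by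
  have hN' : (0 : ℝ) < N₀ := by exact_mod_cast hN
  have h0 : sampleAverage h 0 = sampleSum (h.1 0) / N₀ := by
    simp [sampleAverage, numSamples, hall, sampleSum]
  have h1 : sampleAverage h 1 =
      (sampleSum (h.1 1) + ∑ s, rewardValue (h.2 s).2) / ((N₀ : ℝ) + t) := by
    simp [sampleAverage, numSamples, hall, sampleSum]
  have h2 : sampleAverage h 0 ≤ x := by rw [h0]; exact (div_le_iff₀ hN').mpr hlow
  have h3 : x < sampleAverage h 1 := by
    rw [h1, lt_div_iff₀ (by positivity)]
    unfold excess at hpos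
    linarith
  exact h2.trans_lt h3

/-- The potential is a submartingale, one step: `exp (-l * excess)` is a supermartingale as long as
the second arm is chosen, because the drift `μ 1 - x` is at least `l`. -/
theorem potential_le_expect_step {μ : Fin 2 → unitInterval} {N₀ t : ℕ} (hN : 1 ≤ N₀) {x l : ℝ}
    (hx0 : 0 ≤ x) (hl0 : 0 < l) (hl1 : l ≤ 1) (hdrift : l ≤ (μ 1 : ℝ) - x)
    {ind : IndexRule N₀ t} (hind : IsUnbiased ind) (h : History N₀ t) :
    potential x l h ≤ expect (chooseArm (ind h)) fun a => expect (rewardLaw (μ a)) fun r =>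
      potential x l ((h.1, Fin.snoc h.2 (a, r)) : History N₀ (t + 1)) := by
  rcases (potential_nonneg x l h).eq_or_lt with h0 | hpos
  · rw [← h0]
    exact expect_nonneg _ fun a => expect_nonneg _ fun r => potential_nonneg _ _ _
  by_cases hc : (∀ s, (h.2 s).1 = 1) ∧ sampleSum (h.1 0) ≤ x * N₀
  swap
  · simp [potential, hc] at hpos
  have hval : potential x l h = max 0 (1 - Real.exp (-l * excess x h)) := if_pos hc
  rw [hval] at hpos ⊢
  have hpos' : 0 < 1 - Real.exp (-l * excess x h) := by
    rcases lt_max_iff.mp hpos with h1 | h1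
    · exact absurd h1 (lt_irrefl _)
    · exact h1
  have hex : 0 < excess x h := by
    have := Real.exp_lt_one_iff.mp (sub_pos.mp hpos')
    nlinarith
  have hlt : ind h 0 < ind h 1 := by
    rw [hind h 0, hind h 1]
    exact sampleAverage_lt_of_excess_pos hN hc.1 hc.2 hex
  rw [chooseArm_eq_pure hlt, expect_pure, max_eq_right hpos'.le]
  have hstep : ∀ r, 1 - Real.exp (-l * excess x h) * Real.exp (-l * (rewardValue r - x)) ≤
      potential x l ((h.1, Fin.snoc h.2 (1, r)) : History N₀ (t + 1)) := by
    intro r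
    have hc' : (∀ s : Fin (t + 1),
        ((Fin.snoc h.2 (1, r) : Fin (t + 1) → Fin 2 × Bool) s).1 = 1) ∧
          sampleSum (h.1 0) ≤ x * N₀ := by
      refine ⟨fun s => ?_, hc.2⟩
      refine Fin.lastCases ?_ (fun s => ?_) s
      · simp
      · simpa using hc.1 s
    rw [potential, if_pos hc', excess_snoc, mul_add, Real.exp_add]
    exact le_max_right _ _
  refine le_trans ?_ (expect_mono _ hstep)
  have hmgf := bernoulli_mgf_le (μ 1).2.1 (μ 1).2.2 hx0 (by linarith [(μ 1).2.2] : x ≤ 1)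
    (by rw [abs_neg, abs_of_pos hl0]; exact hl1 : |-l| ≤ 1)
  have hmgf' : (μ 1 : ℝ) * Real.exp (-l * (1 - x)) + (1 - (μ 1 : ℝ)) * Real.exp (-l * (0 - x))
      ≤ 1 := by nlinarith
  have := mul_le_mul_of_nonneg_left hmgf' (Real.exp_pos (-l * excess x h)).le
  simp only [expect, Fintype.sum_bool, rewardLaw_toReal, bernoulliWeight, rewardValue]
  simp only [if_true, Bool.false_eq_true, if_false]
  linarith

theorem expect_potential_le {μ : Fin 2 → unitInterval} {N₀ T : ℕ} (hN : 1 ≤ N₀) {x l : ℝ}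
    (hx0 : 0 ≤ x) (hl0 : 0 < l) (hl1 : l ≤ 1) (hdrift : l ≤ (μ 1 : ℝ) - x)
    {ind : (t : ℕ) → IndexRule N₀ t} (hind : ∀ t < T, IsUnbiased (ind t)) {t : ℕ} (ht : t ≤ T) :
    expect (historyLaw μ N₀ ind 0) (potential x l) ≤
      expect (historyLaw μ N₀ ind t) (potential x l) := by
  induction t with
  | zero => exact le_rfl
  | succ t ih =>
    refine (ih (by omega)).trans ?_
    simp only [historyLaw, expect_bind, expect_map]
    exact expect_mono _ fun h => potential_le_expect_step hN hx0 hl0 hl1 hdrift (hind t ht) h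

theorem expect_potential_le_failureProb {μ : Fin 2 → unitInterval} {N₀ T : ℕ} (x l : ℝ)
    (ind : (t : ℕ) → IndexRule N₀ t) :
    expect (historyLaw μ N₀ ind T) (potential x l) ≤ failureProb μ N₀ ind T 0 := by
  classical
  rw [failureProb, measureReal_eq_expect]
  refine expect_mono _ fun h => ?_
  unfold potential
  split_ifs with h1 h2 h2
  · exact max_le zero_le_one (by linarith [Real.exp_pos (-l * excess x h)])
  · exact absurd (by simp [samplingFailure, h1.1]) h2
  · exact zero_le_one
  · exact le_rfl

/-- If the first initial sample of the second arm is a success, its excess already equals `1 - x`,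
and from then on `exp (-l * excess)` is a supermartingale. -/
theorem le_sum_sampleWeight_max {n : ℕ} (hn : 1 ≤ n) {p x l : ℝ} (hp0 : 0 ≤ p) (hp1 : p ≤ 1)
    (hx0 : 0 ≤ x) (hl0 : 0 < l) (hl1 : l ≤ 1) (hdrift : l ≤ p - x) :
    p * (1 - Real.exp (-l * (1 - x))) ≤
      ∑ y : Fin n → Bool, sampleWeight p y * max 0 (1 - Real.exp (-l * (sampleSum y - x * n))) := by
  obtain ⟨m, rfl⟩ : ∃ m, n = m + 1 := ⟨n - 1, by omega⟩
  have hmgf := bernoulli_mgf_le hp0 hp1 hx0 (by linarith : x ≤ 1)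
    (by rw [abs_neg, abs_of_pos hl0]; exact hl1 : |-l| ≤ 1)
  have hmgf' : p * Real.exp (-l * (1 - x)) + (1 - p) * Real.exp (-l * (0 - x)) ≤ 1 := by nlinarith
  -- `u` is the indicator that the first sample is a success, written as a product over samples.
  let u : Fin (m + 1) → Bool → ℝ := Fin.cons (fun r => if r then 1 else 0) fun _ _ => 1
  have h1 : ∑ y : Fin (m + 1) → Bool, sampleWeight p y * ∏ i, u i (y i) = p := by
    rw [sum_sampleWeight_mul_prod, Fin.prod_univ_succ]
    simp [u]
  have h2 : ∑ y : Fin (m + 1) → Bool, sampleWeight p y *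
      ∏ i, (u i (y i) * Real.exp (-l * (rewardValue (y i) - x))) ≤
        p * Real.exp (-l * (1 - x)) := by
    rw [sum_sampleWeight_mul_prod p fun i r => u i r * Real.exp (-l * (rewardValue r - x)),
      Fin.prod_univ_succ]
    simp only [u, Fin.cons_zero, Fin.cons_succ, if_true, Bool.false_eq_true, if_false, one_mul,
      zero_mul, mul_zero, add_zero, rewardValue, Finset.prod_const]
    have h3 : 0 ≤ 1 - p := by linarith
    exact mul_le_of_le_one_right (by positivity) (pow_le_one₀ (by positivity) hmgf')
  have h4 : ∀ y : Fin (m + 1) → Bool, ∏ i, u i (y i) = if y 0 then 1 else 0 := by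
    intro y
    rw [Fin.prod_univ_succ]
    simp [u]
  calc p * (1 - Real.exp (-l * (1 - x)))
      ≤ ∑ y : Fin (m + 1) → Bool, sampleWeight p y * ((∏ i, u i (y i)) -
          ∏ i, (u i (y i) * Real.exp (-l * (rewardValue (y i) - x)))) := by
        rw [Finset.sum_congr rfl fun y _ => mul_sub (sampleWeight p y) _ _,
          Finset.sum_sub_distrib, h1]
        linarith
    _ ≤ _ := by
        refine Finset.sum_le_sum fun y _ =>
          mul_le_mul_of_nonneg_left ?_ (sampleWeight_nonneg hp0 hp1 y)
        rw [Finset.prod_mul_distrib, ← exp_mul_sampleSum_sub, h4]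
        split_ifs
        · rw [one_mul]
          exact le_max_right _ _
        · simp

theorem le_expect_potential_zero {μ : Fin 2 → unitInterval} {N₀ : ℕ} (hN : 1 ≤ N₀) {x l : ℝ}
    (hx0 : 0 ≤ x) (hl0 : 0 < l) (hl1 : l ≤ 1) (hdrift : l ≤ (μ 1 : ℝ) - x)
    (ind : (t : ℕ) → IndexRule N₀ t) :
    (∑ y : Fin N₀ → Bool with sampleSum y ≤ x * N₀, sampleWeight (μ 0) y) *
        ((μ 1 : ℝ) * (1 - Real.exp (-l * (1 - x)))) ≤
      expect (historyLaw μ N₀ ind 0) (potential x l) := by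
  classical
  rw [historyLaw, expect_map]
  have h1 : (fun z : Fin 2 → Fin N₀ → Bool =>
      potential x l ((z, Fin.elim0) : History N₀ 0)) = fun z =>
        (if sampleSum (z 0) ≤ x * N₀ then 1 else 0) *
          max 0 (1 - Real.exp (-l * (sampleSum (z 1) - x * N₀))) := by
    funext z
    simp [potential, excess]
  rw [h1, expect_initialLaw_mul μ N₀ (fun y => if sampleSum y ≤ x * N₀ then 1 else 0)
    (fun y => max 0 (1 - Real.exp (-l * (sampleSum y - x * N₀))))]
  simp only [mul_ite, mul_one, mul_zero]
  rw [← Finset.sum_filter]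
  exact mul_le_mul_of_nonneg_left
    (le_sum_sampleWeight_max hN (μ 1).2.1 (μ 1).2.2 hx0 hl0 hl1 hdrift)
    (Finset.sum_nonneg fun y _ => sampleWeight_nonneg (μ 0).2.1 (μ 0).2.2 y)

/-! ### Failure probability and regret -/

theorem le_failureProb {c : ℝ} (hc0 : 0 < c) (hc1 : c < 1 / 2) {μ : Fin 2 → unitInterval}
    {N₀ T : ℕ} (hN : 1 ≤ N₀) {ind : (t : ℕ) → IndexRule N₀ t} (h1 : c < (μ 1 : ℝ))
    (h10 : (μ 1 : ℝ) < μ 0) (h0 : (μ 0 : ℝ) < 1 - c) (hind : ∀ t < T, IsUnbiased (ind t)) :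
    c ^ 3 / 8 * Real.exp (-(16 / c)) * ((μ 0 : ℝ) - μ 1) *
        Real.exp (-(16 / c * (N₀ * ((μ 0 : ℝ) - μ 1) ^ 2))) ≤
      failureProb μ N₀ ind T 0 := by
  set Δ : ℝ := (μ 0 : ℝ) - μ 1 with hΔ
  have hΔ0 : 0 < Δ := sub_pos.mpr h10
  have hΔ1 : Δ < 1 := by linarith
  have hcΔ : c * Δ < c := by nlinarith
  -- The threshold `x` lies slightly below `μ 1`, so close that it is still nonnegative.
  set x : ℝ := (μ 1 : ℝ) - c * Δ with hx
  have hx0 : 0 ≤ x := by linarith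
  have hl0 : 0 < c * Δ := mul_pos hc0 hΔ0
  have hpot := (le_expect_potential_zero hN hx0 hl0 (by linarith) (by linarith) ind).trans
    ((expect_potential_le hN hx0 hl0 (by linarith) (by linarith) hind le_rfl).trans
      (expect_potential_le_failureProb x (c * Δ) ind))
  refine le_trans ?_ hpot
  have htail := le_sum_sampleWeight_lower_tail hN (p := (μ 0 : ℝ)) (x := x) (by linarith)
    (by linarith) hx0 (by linarith)
  have hv : c / 2 ≤ (μ 0 : ℝ) * (1 - μ 0) := by nlinarith
  have hexp : (2 * (N₀ * ((μ 0 : ℝ) - x) ^ 2) + 8) / ((μ 0 : ℝ) * (1 - μ 0)) ≤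
      16 / c * (N₀ * Δ ^ 2) + 16 / c := by
    have h2 : ((μ 0 : ℝ) - x) ^ 2 ≤ 4 * Δ ^ 2 := by
      have : (μ 0 : ℝ) - x = (1 + c) * Δ := by rw [hx, hΔ]; ring
      rw [this, mul_pow]
      exact mul_le_mul_of_nonneg_right (by nlinarith) (sq_nonneg Δ)
    have h3 : (N₀ : ℝ) * ((μ 0 : ℝ) - x) ^ 2 ≤ N₀ * (4 * Δ ^ 2) :=
      mul_le_mul_of_nonneg_left h2 (Nat.cast_nonneg N₀)
    calc _ ≤ (8 * (N₀ * Δ ^ 2) + 8) / (c / 2) :=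
          div_le_div₀ (by positivity) (by linarith) (by positivity) hv
      _ = _ := by field_simp; ring
  have htail' : 1 / 4 * (Real.exp (-(16 / c)) * Real.exp (-(16 / c * (N₀ * Δ ^ 2)))) ≤
      ∑ y : Fin N₀ → Bool with sampleSum y ≤ x * N₀, sampleWeight (μ 0 : ℝ) y := by
    refine le_trans ?_ htail
    rw [← Real.exp_add]
    exact mul_le_mul_of_nonneg_left (Real.exp_le_exp.mpr (by linarith)) (by norm_num)
  have hwalk : c * (c ^ 2 * Δ / 2) ≤ (μ 1 : ℝ) * (1 - Real.exp (-(c * Δ) * (1 - x))) := by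
    have hy0 : 0 ≤ c ^ 2 * Δ := by positivity
    have hy1 : c ^ 2 * Δ ≤ 1 / 2 := by nlinarith
    have h4 : Real.exp (-(c * Δ) * (1 - x)) ≤ 1 - c ^ 2 * Δ / 2 := by
      have h5 : Real.exp (-(c * Δ) * (1 - x)) ≤ Real.exp (-(c ^ 2 * Δ)) :=
        Real.exp_le_exp.mpr (by nlinarith)
      have h6 := (abs_le.mp (Real.abs_exp_sub_one_sub_id_le
        (by rw [abs_neg, abs_of_nonneg hy0]; linarith : |-(c ^ 2 * Δ)| ≤ 1))).2
      nlinarith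
    exact mul_le_mul h1.le (by linarith) (by positivity) (by linarith)
  calc _ = 1 / 4 * (Real.exp (-(16 / c)) * Real.exp (-(16 / c * (N₀ * Δ ^ 2)))) *
        (c * (c ^ 2 * Δ / 2)) := by ring
    _ ≤ _ := mul_le_mul htail' hwalk (by positivity) (le_trans (by positivity) htail')

theorem mul_failureProb_le_regret {μ : Fin 2 → unitInterval} (h10 : (μ 1 : ℝ) < μ 0)
    (N₀ T : ℕ) (ind : (t : ℕ) → IndexRule N₀ t) :
    ((μ 0 : ℝ) - μ 1) * failureProb μ N₀ ind T 0 * T ≤ regret μ N₀ ind T := by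
  classical
  rw [regret, integral_eq_expect, failureProb, measureReal_eq_expect, max_eq_left h10.le]
  have hle : expect (historyLaw μ N₀ ind T) (fun h => (∑ t : Fin T, (μ (h.2 t).1 : ℝ)) +
      ((μ 0 : ℝ) - μ 1) * T * (if h ∈ samplingFailure N₀ T 0 then 1 else 0)) ≤
        expect (historyLaw μ N₀ ind T) fun _ => (μ 0 : ℝ) * T := by
    refine expect_mono _ fun h => ?_
    split_ifs with hf
    · have hall : ∀ t, (h.2 t).1 = 1 := by
        simpa [samplingFailure, Finset.filter_eq_empty_iff] using hf
      simp only [hall, Finset.sum_const, Finset.card_univ, Fintype.card_fin, nsmul_eq_mul]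
      linarith
    · have hle : ∀ a : Fin 2, (μ a : ℝ) ≤ μ 0 := by
        intro a
        fin_cases a
        · exact le_rfl
        · exact h10.le
      have := Finset.sum_le_sum fun (t : Fin T) (_ : t ∈ Finset.univ) => hle (h.2 t).1
      simp only [Finset.sum_const, Finset.card_univ, Fintype.card_fin, nsmul_eq_mul] at this
      linarith
  rw [expect_const] at hle
  have hsplit : expect (historyLaw μ N₀ ind T) (fun h => (∑ t : Fin T, (μ (h.2 t).1 : ℝ)) +
      ((μ 0 : ℝ) - μ 1) * T * (if h ∈ samplingFailure N₀ T 0 then 1 else 0)) =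
        expect (historyLaw μ N₀ ind T) (fun h => ∑ t : Fin T, (μ (h.2 t).1 : ℝ)) +
          ((μ 0 : ℝ) - μ 1) * T * expect (historyLaw μ N₀ ind T)
            (fun h => if h ∈ samplingFailure N₀ T 0 then 1 else 0) := by
    simp only [expect, mul_add, Finset.sum_add_distrib]
    rw [Finset.mul_sum]
    congr 1
    exact Finset.sum_congr rfl fun h _ => by ring
  linarith

theorem regret_ge_of_le_failureProb {μ : Fin 2 → unitInterval} (h10 : (μ 1 : ℝ) < μ 0)
    {N₀ T : ℕ} {ind : (t : ℕ) → IndexRule N₀ t} {P : ℝ} (hP : P ≤ failureProb μ N₀ ind T 0) :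
    ((μ 0 : ℝ) - μ 1) * P * T ≤ regret μ N₀ ind T :=
  le_trans (mul_le_mul_of_nonneg_right (mul_le_mul_of_nonneg_left hP (sub_nonneg.mpr h10.le))
    (Nat.cast_nonneg T)) (mul_failureProb_le_regret h10 N₀ T ind)

end BanditSocialLearning

open BanditSocialLearning in
theorem corollary3p4 (c : ℝ) (hc0 : 0 < c) (hc1 : c < 1 / 2) :
    (∃ C₁ C₂ : ℝ, 0 < C₁ ∧ 0 < C₂ ∧
      ∀ (μ : Fin 2 → unitInterval) (N₀ T : ℕ) (ind : (t : ℕ) → IndexRule N₀ t),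
        c < (μ 1 : ℝ) → (μ 1 : ℝ) < (μ 0 : ℝ) → (μ 0 : ℝ) < 1 - c →
        1 / c ≤ (N₀ : ℝ) →
        (∀ t < T, IsUnbiased (ind t)) →
        C₁ * ((μ 0 : ℝ) - μ 1) * Real.exp (-(C₂ * (N₀ * ((μ 0 : ℝ) - μ 1) ^ 2))) ≤
            failureProb μ N₀ ind T 0 ∧
        ((μ 0 : ℝ) - μ 1) *
            (C₁ * ((μ 0 : ℝ) - μ 1) * Real.exp (-(C₂ * (N₀ * ((μ 0 : ℝ) - μ 1) ^ 2)))) * T ≤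
          regret μ N₀ ind T) ∧
    (∀ K : ℝ, 0 < K → ∃ C₃ : ℝ, 0 < C₃ ∧
      ∀ (μ : Fin 2 → unitInterval) (N₀ T : ℕ) (ind : (t : ℕ) → IndexRule N₀ t),
        c < (μ 1 : ℝ) → (μ 1 : ℝ) < (μ 0 : ℝ) → (μ 0 : ℝ) < 1 - c →
        1 / c ≤ (N₀ : ℝ) →
        (∀ t < T, IsUnbiased (ind t)) →
        (μ 0 : ℝ) - μ 1 ≤ K / Real.sqrt N₀ →
        C₃ * ((μ 0 : ℝ) - μ 1) ≤ failureProb μ N₀ ind T 0 ∧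
        ((μ 0 : ℝ) - μ 1) * (C₃ * ((μ 0 : ℝ) - μ 1)) * T ≤ regret μ N₀ ind T) := by
  have hC₁ : 0 < c ^ 3 / 8 * Real.exp (-(16 / c)) := by positivity
  have hN : ∀ N₀ : ℕ, 1 / c ≤ (N₀ : ℝ) → 1 ≤ N₀ := by
    intro N₀ h
    have : (0 : ℝ) < N₀ := lt_of_lt_of_le (by positivity) h
    exact_mod_cast this
  refine ⟨⟨c ^ 3 / 8 * Real.exp (-(16 / c)), 16 / c, hC₁, by positivity, ?_⟩, fun K hK =>
    ⟨c ^ 3 / 8 * Real.exp (-(16 / c)) * Real.exp (-(16 / c * K ^ 2)), by positivity, ?_⟩⟩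
  · intro μ N₀ T ind h1 h10 h0 hN₀ hind
    have h := le_failureProb hc0 hc1 (hN N₀ hN₀) h1 h10 h0 hind
    exact ⟨h, regret_ge_of_le_failureProb h10 h⟩
  · intro μ N₀ T ind h1 h10 h0 hN₀ hind hK'
    have hpos : (0 : ℝ) < N₀ := lt_of_lt_of_le (by positivity) hN₀
    have hsq : (N₀ : ℝ) * ((μ 0 : ℝ) - μ 1) ^ 2 ≤ K ^ 2 := by
      have h2 := pow_le_pow_left₀ (sub_nonneg.mpr h10.le) hK' 2
      rw [div_pow, Real.sq_sqrt hpos.le, le_div_iff₀ hpos] at h2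
      linarith
    have h : c ^ 3 / 8 * Real.exp (-(16 / c)) * Real.exp (-(16 / c * K ^ 2)) *
        ((μ 0 : ℝ) - μ 1) ≤ failureProb μ N₀ ind T 0 := by
      refine le_trans ?_ (le_failureProb hc0 hc1 (hN N₀ hN₀) h1 h10 h0 hind)
      rw [mul_right_comm]
      refine mul_le_mul_of_nonneg_left (Real.exp_le_exp.mpr (neg_le_neg ?_))
        (mul_nonneg hC₁.le (sub_nonneg.mpr h10.le))
      exact mul_le_mul_of_nonneg_left hsq (by positivity)
    exact ⟨h, regret_ge_of_le_failureProb h10 h⟩
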